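/- A \emph{continuum} is a compact connected metrizable space with more than one point; a \emph{subcontinuum} of a continuum $Y$ is a nonempty compact connected subset of $Y$ (one-point subsets being allowed). A continuum $Y$ is \emph{indecomposable} if it is not the union of two proper subcontinua. The \emph{meager composant} of a point $x \in Y$ is the union of all subcontinua of $Y$ that contain $x$ and are nowhere dense in $Y$. A subcontinuum $K$ of $Y$ is \emph{filament} if there is a neighborhood $N$ of $K$ in $Y$ such that the connected component of $N$ containing $K$ is nowhere dense in $Y$. A subset $X \subseteq Y$ is a \emph{filament set} if every subcontinuum of $Y$ contained in $X$ is filament. A connected subset $X \subseteq Y$ is \emph{singular} in $Y$ if there is a point $y \in Y$ such that every connected $C \subseteq X$ whose closure in $Y$ contains $y$ is dense in $X$; it is \emph{singular dense} if it is singular and dense in $Y$. \textbf{Theorem.} A continuum $Y$ is indecomposable if and only if there is a point $x \in Y$ whose meager composant is both a singular dense set and a filament set. -/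

import Mathlib

namespace ContinuumTheory

variable {Y : Type*} [TopologicalSpace Y]

/-- Subcontinua of a space: nonempty compact connected subsets.
One-point sets are allowed, so that every point lies in its own meager composant. -/
def IsSubcontinuum (K : Set Y) : Prop :=
  IsCompact K ∧ IsConnected K

/-- `Y` is not the union of two proper subcontinua. -/
def IsIndecomposable (Y : Type*) [TopologicalSpace Y] : Prop :=
  ¬ ∃ H K : Set Y, IsSubcontinuum H ∧ IsSubcontinuum K ∧
    H ≠ Set.univ ∧ K ≠ Set.univ ∧ H ∪ K = Set.univ

/-- The meager composant of `x`: the union of all nowhere dense subcontinua containing `x`. -/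
def meagerComposant (x : Y) : Set Y :=
  ⋃₀ {K : Set Y | IsSubcontinuum K ∧ IsNowhereDense K ∧ x ∈ K}

/-- A subcontinuum `K` is filament if it has a neighborhood `N` such that the connected component
of `N` containing `K` is nowhere dense. As `K` is connected and nonempty, that component is
`connectedComponentIn N x` for each point `x` of `K`. -/
def IsFilament (K : Set Y) : Prop :=
  IsSubcontinuum K ∧
    ∃ N ∈ nhdsSet K, ∀ x ∈ K, IsNowhereDense (connectedComponentIn N x)

/-- Every continuum inside `X` is a filament subcontinuum of `Y`. -/
def IsFilamentSet (X : Set Y) : Prop :=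
  ∀ K : Set Y, IsSubcontinuum K → K ⊆ X → IsFilament K

/-- `X` is singular with respect to `y`: each connected `C ⊆ X` whose closure in `Y` contains `y`
is dense in `X`. The set `closure C ∩ X` is the closure of `C` in the subspace `X`. -/
def IsSingularWrt (X : Set Y) (y : Y) : Prop :=
  IsConnected X ∧
    ∀ C : Set Y, C ⊆ X → IsConnected C → y ∈ closure C → closure C ∩ X = X

/-- `X` is singular with respect to some point of `Y`. -/
def IsSingular (X : Set Y) : Prop :=
  ∃ y : Y, IsSingularWrt X y

/-- `X` is both singular and dense in `Y`. -/
def IsSingularDense (X : Set Y) : Prop :=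
  IsSingular X ∧ Dense X

end ContinuumTheory

/-!
A connected set `C` in a connected dense set `X`, neither dense nor nowhere dense, splits `X`: if
`F` is the closure of `C`, then either `X \ F` is connected, or each of the two parts of a
separation of `X \ F` is connected together with `X ∩ F`. In both cases `X` is the union of two
connected sets that are not dense. For `X = Y` this makes proper subcontinua of an indecomposable
`Y` nowhere dense; for a singular dense `X` it makes every connected subset of `X` dense or nowhere
dense.

If `Y` is indecomposable, the meager composant of any `x` is dense by boundary bumping and meager,
being covered by the components at `x` of the complements of basic open sets. It therefore misses
some point `y`, and is singular with respect to `y`.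

Conversely, suppose that some meager composant `X` is a singular dense filament set, and that a
proper subcontinuum `H` has interior. Choose `p ∈ X` in that interior. The nowhere dense subcontinua
of `H` through `p` have a connected union in `X` that is not dense, so the closure of the union is a
largest one. It lies in `X` and is filament, so boundary bumping in a small neighborhood of it
produces a nowhere dense subcontinuum of `H` through `p` that it does not contain: a contradiction.
-/

namespace ContinuumTheory

open Set TopologicalSpace

section Connected

variable {Z : Type*} [TopologicalSpace Z] {X A C F u v : Set Z}

theorem isPreconnected_sdiff_of_separation (hX : IsPreconnected X) (hA : IsPreconnected A)
    (hAX : A ⊆ X) (hAv : Disjoint A v) (hu : IsOpen u) (hv : IsOpen v) (hcover : X \ A ⊆ u ∪ v)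
    (hdisj : X ∩ (u ∩ v) = ∅) : IsPreconnected (X \ v) := by
  have hAXv : A ⊆ X \ v := subset_sdiff.2 ⟨hAX, hAv⟩
  rw [isPreconnected_iff_subset_of_disjoint]
  intro s t hs ht hst hst'
  wlog hAs : A ⊆ s generalizing s t
  · have hAt : A ⊆ t := (isPreconnected_iff_subset_of_disjoint.1 hA s t hs ht (hAXv.trans hst)
      (subset_eq_empty (inter_subset_inter_left _ hAXv) hst')).resolve_left hAs
    exact (this t s ht hs (by rwa [union_comm]) (by rwa [inter_comm t]) hAt).symm
  rw [eq_empty_iff_forall_notMem] at hdisj hst'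
  -- As `A ⊆ s`, the part of `X \ v` outside `s` lies in `u`, so `s ∪ v` and `t ∩ u` separate `X`.
  have hX_cover : X ⊆ (s ∪ v) ∪ (t ∩ u) := by
    intro z hz
    have := @hcover z
    have := @hst z
    have := @hAs z
    grind
  have hX_disj : X ∩ ((s ∪ v) ∩ (t ∩ u)) = ∅ := by
    refine eq_empty_of_forall_notMem fun z hz => ?_
    have := hdisj z
    have := hst' z
    grind
  refine (isPreconnected_iff_subset_of_disjoint.1 hX _ _ (hs.union hv) (ht.inter hu)
    hX_cover hX_disj).imp (fun h z hz => (h hz.1).resolve_right hz.2) fun h z hz => (h hz.1).1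

theorem exists_isConnected_sdiff_of_not_isPreconnected_sdiff (hX : IsPreconnected X)
    (hF : IsClosed F) (hXF : IsConnected (X ∩ F)) (h : ¬ IsPreconnected (X \ F)) :
    ∃ u v, (IsOpen u ∧ u.Nonempty ∧ IsConnected (X \ u)) ∧
      (IsOpen v ∧ v.Nonempty ∧ IsConnected (X \ v)) ∧ X ∩ (u ∩ v) = ∅ := by
  simp only [IsPreconnected, not_forall, not_nonempty_iff_eq_empty] at h
  obtain ⟨u, v, hu, hv, hcover, ⟨a, ⟨-, haF⟩, hau⟩, ⟨b, ⟨-, hbF⟩, hbv⟩, hdisj⟩ := h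
  have hcover' : X \ (X ∩ F) ⊆ u \ F ∪ v \ F := by
    rw [sdiff_self_inter, ← union_sdiff_distrib]
    exact subset_sdiff.2 ⟨hcover, disjoint_sdiff_left⟩
  have hdisj' : X ∩ (u \ F ∩ (v \ F)) = ∅ := by
    refine subset_eq_empty ?_ hdisj
    rintro z ⟨hz, ⟨hzu, hzF⟩, hzv, -⟩
    exact ⟨⟨hz, hzF⟩, hzu, hzv⟩
  have hF_disj (w : Set Z) : Disjoint (X ∩ F) (w \ F) :=
    disjoint_sdiff_right.mono_left inter_subset_right
  have hne (w : Set Z) : (X \ (w \ F)).Nonempty :=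
    hXF.nonempty.mono (subset_sdiff.2 ⟨inter_subset_left, hF_disj w⟩)
  refine ⟨u \ F, v \ F, ⟨hu.sdiff hF, ⟨a, hau, haF⟩, hne u, ?_⟩,
    ⟨hv.sdiff hF, ⟨b, hbv, hbF⟩, hne v, ?_⟩, hdisj'⟩
  · exact isPreconnected_sdiff_of_separation hX hXF.isPreconnected inter_subset_left (hF_disj u)
      (hv.sdiff hF) (hu.sdiff hF) (by rwa [union_comm]) (by rwa [inter_comm (v \ F)])
  · exact isPreconnected_sdiff_of_separation hX hXF.isPreconnected inter_subset_left (hF_disj v)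
      (hu.sdiff hF) (hv.sdiff hF) hcover' hdisj'

theorem not_dense_sdiff (hu : IsOpen u) (hne : u.Nonempty) : ¬ Dense (X \ u) :=
  fun h =>
    let ⟨_, hzu, hz⟩ := h.inter_open_nonempty u hu hne
    hz.2 hzu

theorem exists_isConnected_union_eq_of_not_dense (hX : IsPreconnected X) (hXd : Dense X)
    (hC : IsConnected C) (hCX : C ⊆ X) (hCd : ¬ Dense C) (hCn : ¬ IsNowhereDense C) :
    ∃ A B : Set Z, IsConnected A ∧ IsConnected B ∧ ¬ Dense A ∧ ¬ Dense B ∧ A ∪ B = X := by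
  have hXC : IsConnected (X ∩ closure C) :=
    hC.subset_closure (subset_inter hCX subset_closure) inter_subset_right
  by_cases h : IsPreconnected (X \ closure C)
  · have hXC_not_dense : ¬ Dense (X ∩ closure C) := fun hd =>
      hCd (dense_closure.1 (hd.mono inter_subset_right))
    have hne : (X \ closure C).Nonempty := sdiff_nonempty.2 fun hsub =>
      hXC_not_dense (by rwa [inter_eq_left.2 hsub])
    have hsdiff_not_dense : ¬ Dense (X \ closure C) := fun hd =>
      not_dense_sdiff isOpen_interior (nonempty_iff_ne_empty.2 hCn)
        (hd.mono (sdiff_subset_sdiff_right interior_subset))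
    exact ⟨X ∩ closure C, X \ closure C, hXC, ⟨hne, h⟩, hXC_not_dense, hsdiff_not_dense,
      inter_union_sdiff X _⟩
  · obtain ⟨u, v, ⟨hu, hu_ne, hXu⟩, ⟨hv, hv_ne, hXv⟩, hdisj⟩ :=
      exists_isConnected_sdiff_of_not_isPreconnected_sdiff hX isClosed_closure hXC h
    refine ⟨X \ u, X \ v, hXu, hXv, not_dense_sdiff hu hu_ne, not_dense_sdiff hv hv_ne, ?_⟩
    rw [← sdiff_inter, sdiff_eq_left, disjoint_iff_inter_eq_empty, hdisj]

end Connected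

section BoundaryBumping

variable {Z : Type*} [TopologicalSpace Z] {F H K U : Set Z} {p : Z}

theorem isClosed_connectedComponentIn (hF : IsClosed F) (p : Z) :
    IsClosed (connectedComponentIn F p) := by
  by_cases hp : p ∈ F
  · exact isClosed_of_closure_subset <|
      isPreconnected_connectedComponentIn.closure.subset_connectedComponentIn
        (subset_closure (mem_connectedComponentIn hp))
        (closure_minimal (connectedComponentIn_subset F p) hF)
  · rw [connectedComponentIn_eq_empty hp]
    exact isClosed_empty

theorem exists_isClopen_of_connectedComponent_subset [CompactSpace Z] [T2Space Z]
    (hU : IsOpen U) (h : connectedComponent p ⊆ U) : ∃ V, IsClopen V ∧ p ∈ V ∧ V ⊆ U := by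
  rw [connectedComponent_eq_iInter_isClopen] at h
  have : Nonempty {s : Set Z // IsClopen s ∧ p ∈ s} := ⟨univ, isClopen_univ, mem_univ p⟩
  obtain ⟨⟨V, hV, hpV⟩, hVU⟩ := exists_subset_nhds_of_compactSpace
    (V := fun s : {s : Set Z // IsClopen s ∧ p ∈ s} => s.1)
    (fun s t => ⟨⟨s ∩ t, s.2.1.inter t.2.1, s.2.2, t.2.2⟩, inter_subset_left, inter_subset_right⟩)
    (fun s => s.2.1.isClosed) fun z hz => hU.mem_nhds (h hz)
  exact ⟨V, hV, hpV, hVU⟩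

theorem exists_isOpen_isClosed_inter_of_connectedComponentIn_subset [T2Space Z]
    (hK : IsCompact K) (hp : p ∈ K) (hU : IsOpen U) (h : connectedComponentIn K p ⊆ U) :
    ∃ W, IsOpen W ∧ IsClosed (K ∩ W) ∧ p ∈ W ∧ K ∩ W ⊆ U := by
  have : CompactSpace K := isCompact_iff_compactSpace.1 hK
  rw [connectedComponentIn_eq_image hp, image_subset_iff] at h
  obtain ⟨V, hV, hpV, hVU⟩ :=
    exists_isClopen_of_connectedComponent_subset (hU.preimage continuous_subtype_val) h
  obtain ⟨W, hW, rfl⟩ := isOpen_induced_iff.1 hV.isOpen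
  refine ⟨W, hW, ?_, hpV, ?_⟩
  · rw [← Subtype.image_preimage_coe]
    exact hK.isClosed.isClosedMap_subtype_val _ hV.isClosed
  · rwa [← Subtype.image_preimage_coe, image_subset_iff]

theorem IsSubcontinuum.exists_subset_closure_not_subset [T2Space Z] (hH : IsSubcontinuum H)
    (hU : IsOpen U) (hHU : ¬ H ⊆ U) (hpH : p ∈ H) (hpU : p ∈ U) :
    ∃ C, IsSubcontinuum C ∧ p ∈ C ∧ C ⊆ H ∩ closure U ∧ ¬ C ⊆ U := by
  have hK : IsCompact (H ∩ closure U) := hH.1.inter_right isClosed_closure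
  have hpK : p ∈ H ∩ closure U := ⟨hpH, subset_closure hpU⟩
  refine ⟨connectedComponentIn (H ∩ closure U) p,
    ⟨hK.of_isClosed_subset (isClosed_connectedComponentIn hK.isClosed p)
      (connectedComponentIn_subset _ p), isConnected_connectedComponentIn_iff.2 hpK⟩,
    mem_connectedComponentIn hpK, connectedComponentIn_subset _ p, fun hCU => hHU ?_⟩
  obtain ⟨W, hW, hKW, hpW, hWU⟩ :=
    exists_isOpen_isClosed_inter_of_connectedComponentIn_subset hK hpK hU hCU
  have hcover : H ⊆ U ∩ W ∪ (H ∩ closure U ∩ W)ᶜ := fun z _ =>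
    or_iff_not_imp_right.2 fun hz =>
      have hzW : z ∈ H ∩ closure U ∩ W := not_not.1 hz
      ⟨hWU hzW, hzW.2⟩
  have hdisj : H ∩ (U ∩ W ∩ (H ∩ closure U ∩ W)ᶜ) = ∅ := eq_empty_of_forall_notMem
    fun z ⟨hzH, ⟨hzU, hzW⟩, hz⟩ => hz ⟨⟨hzH, subset_closure hzU⟩, hzW⟩
  have hHUW : H ⊆ U ∩ W := (isPreconnected_iff_subset_of_disjoint.1 hH.2.isPreconnected _ _
    (hU.inter hW) hKW.isOpen_compl hcover hdisj).resolve_right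
      fun h => h hpH ⟨hpK, hpW⟩
  exact hHUW.trans inter_subset_left

theorem exists_isSubcontinuum_ne_univ_inter_nonempty [CompactSpace Z] [ConnectedSpace Z]
    [T2Space Z] [Nontrivial Z] (x : Z) (hU : IsOpen U) (hne : U.Nonempty) :
    ∃ K, IsSubcontinuum K ∧ K ≠ univ ∧ x ∈ K ∧ (U ∩ K).Nonempty := by
  obtain ⟨z, hz⟩ := hne
  by_cases hxU : x ∈ U
  · exact ⟨{x}, ⟨isCompact_singleton, isConnected_singleton⟩, singleton_ne_univ x, rfl,
      x, hxU, rfl⟩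
  obtain ⟨G, hGz, hG, hGU⟩ := exists_mem_nhds_isClosed_subset (hU.mem_nhds hz)
  obtain ⟨K, hK, hxK, hKG, hKG'⟩ :=
    IsSubcontinuum.exists_subset_closure_not_subset ⟨isCompact_univ, isConnected_univ⟩
      hG.isOpen_compl (fun h => h (mem_univ z) (mem_of_mem_nhds hGz)) (mem_univ x)
      fun hxG => hxU (hGU hxG)
  obtain ⟨c, hcK, hcG⟩ := not_subset.1 hKG'
  refine ⟨K, hK, fun h => ?_, hxK, c, hGU (not_not.1 hcG), hcK⟩
  have hz_closure := (hKG (h ▸ mem_univ z)).2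
  rw [closure_compl] at hz_closure
  exact hz_closure (mem_interior_iff_mem_nhds.2 hGz)

end BoundaryBumping

section NowhereDense

variable {Z : Type*} [TopologicalSpace Z] {s t : Set Z}

theorem isNowhereDense_union (hs : IsNowhereDense s) (ht : IsNowhereDense t) :
    IsNowhereDense (s ∪ t) := by
  rw [IsNowhereDense, closure_union, interior_union_isClosed_of_interior_empty isClosed_closure ht]
  exact hs

theorem not_isNowhereDense_univ [Nonempty Z] : ¬ IsNowhereDense (univ : Set Z) := by
  simp [IsNowhereDense]

end NowhereDense

variable {Y : Type*} [TopologicalSpace Y] {X C H K Q : Set Y} {p x y : Y}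

theorem subset_meagerComposant_of_mem (hp : p ∈ meagerComposant x) (hK : IsSubcontinuum K)
    (hKn : IsNowhereDense K) (hpK : p ∈ K) : K ⊆ meagerComposant x := by
  obtain ⟨L, ⟨hL, hLn, hxL⟩, hpL⟩ := hp
  exact subset_union_left.trans <| subset_sUnion_of_mem
    ⟨⟨hK.1.union hL.1, hK.2.union ⟨p, hpK, hpL⟩ hL.2⟩, isNowhereDense_union hKn hLn, Or.inr hxL⟩

section Indecomposable

variable [CompactSpace Y] [ConnectedSpace Y] [T2Space Y]

theorem isIndecomposable_iff_forall_isNowhereDense :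
    IsIndecomposable Y ↔ ∀ K : Set Y, IsSubcontinuum K → K ≠ univ → IsNowhereDense K := by
  constructor
  · intro hY K hK hne
    by_contra hKn
    have hKd : ¬ Dense K := fun h => hne (hK.1.isClosed.closure_eq ▸ h.closure_eq)
    obtain ⟨A, B, hA, hB, hAd, hBd, hAB⟩ :=
      exists_isConnected_union_eq_of_not_dense isPreconnected_univ dense_univ hK.2 (subset_univ K)
        hKd hKn
    refine hY ⟨closure A, closure B, ⟨isClosed_closure.isCompact, hA.closure⟩,
      ⟨isClosed_closure.isCompact, hB.closure⟩, mt dense_iff_closure_eq.2 hAd,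
      mt dense_iff_closure_eq.2 hBd, ?_⟩
    rw [← closure_union, hAB, closure_univ]
  · rintro h ⟨H, K, hH, hK, hHne, hKne, hHK⟩
    exact not_isNowhereDense_univ (hHK ▸ isNowhereDense_union (h H hH hHne) (h K hK hKne))

namespace IsIndecomposable

theorem isNowhereDense (hY : IsIndecomposable Y) (hK : IsSubcontinuum K)
    (hne : K ≠ univ) : IsNowhereDense K :=
  isIndecomposable_iff_forall_isNowhereDense.1 hY K hK hne

theorem isNowhereDense_connectedComponentIn {F : Set Y} (hY : IsIndecomposable Y)
    (hF : IsClosed F) (hne : F ≠ univ) (x : Y) : IsNowhereDense (connectedComponentIn F x) := by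
  by_cases hx : x ∈ F
  · exact hY.isNowhereDense ⟨(isClosed_connectedComponentIn hF x).isCompact,
      isConnected_connectedComponentIn_iff.2 hx⟩
      fun h => hne (univ_subset_iff.1 (h ▸ connectedComponentIn_subset F x))
  · rw [connectedComponentIn_eq_empty hx]
    exact isNowhereDense_empty

theorem isFilamentSet (hY : IsIndecomposable Y) (hX : X ≠ univ) : IsFilamentSet X := by
  intro K hK hKX
  obtain ⟨w, hw⟩ := (ne_univ_iff_exists_notMem X).1 hX
  obtain ⟨V, hV, hKV, hVw⟩ := normal_exists_closure_subset hK.1.isClosed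
    (isOpen_compl_singleton (x := w)) (subset_compl_singleton_iff.2 fun h => hw (hKX h))
  have hne : closure V ≠ univ :=
    (ne_univ_iff_exists_notMem _).2 ⟨w, subset_compl_singleton_iff.1 hVw⟩
  exact ⟨hK, closure V, Filter.mem_of_superset (hV.mem_nhdsSet.2 hKV) subset_closure,
    fun z _ => hY.isNowhereDense_connectedComponentIn isClosed_closure hne z⟩

theorem mem_meagerComposant_self [Nontrivial Y] (hY : IsIndecomposable Y) (x : Y) :
    x ∈ meagerComposant x :=
  have hx : IsSubcontinuum {x} := ⟨isCompact_singleton, isConnected_singleton⟩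
  ⟨{x}, ⟨hx, hY.isNowhereDense hx (singleton_ne_univ x), rfl⟩, rfl⟩

theorem dense_meagerComposant [Nontrivial Y] (hY : IsIndecomposable Y) (x : Y) :
    Dense (meagerComposant x) := by
  rw [dense_iff_inter_open]
  intro U hU hne
  obtain ⟨K, hK, hKne, hxK, hUK⟩ := exists_isSubcontinuum_ne_univ_inter_nonempty x hU hne
  exact hUK.mono (inter_subset_inter_right U
    (subset_sUnion_of_mem ⟨hK, hY.isNowhereDense hK hKne, hxK⟩))

theorem isMeagre_meagerComposant [SecondCountableTopology Y] (hY : IsIndecomposable Y) (x : Y) :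
    IsMeagre (meagerComposant x) := by
  rw [isMeagre_iff_countable_union_isNowhereDense]
  refine ⟨(fun U => connectedComponentIn Uᶜ x) '' countableBasis Y, ?_,
    (countable_countableBasis Y).image _, sUnion_subset fun K ⟨hK, hKn, hxK⟩ => ?_⟩
  · rintro _ ⟨U, hU, rfl⟩
    exact hY.isNowhereDense_connectedComponentIn (isOpen_of_mem_countableBasis hU).isClosed_compl
      (compl_ne_univ.2 (nonempty_of_mem_countableBasis hU)) x
  · have hKne : K ≠ univ := fun h => not_isNowhereDense_univ (h ▸ hKn)
    obtain ⟨z, hz⟩ := (ne_univ_iff_exists_notMem K).1 hKne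
    obtain ⟨U, hU, -, hUK⟩ := (isBasis_countableBasis Y).exists_subset_of_mem_open
      (mem_compl hz) hK.1.isClosed.isOpen_compl
    exact (hK.2.isPreconnected.subset_connectedComponentIn hxK (subset_compl_comm.1 hUK)).trans
      (subset_sUnion_of_mem (mem_image_of_mem _ hU))

theorem meagerComposant_ne_univ [SecondCountableTopology Y] (hY : IsIndecomposable Y) (x : Y) :
    meagerComposant x ≠ univ := fun h =>
  not_isMeagre_of_isOpen isOpen_univ univ_nonempty (h ▸ hY.isMeagre_meagerComposant x)

theorem isSingularWrt_meagerComposant [Nontrivial Y] (hY : IsIndecomposable Y)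
    (hy : y ∉ meagerComposant x) :
    IsSingularWrt (meagerComposant x) y := by
  refine ⟨⟨⟨x, hY.mem_meagerComposant_self x⟩, isPreconnected_sUnion x _ (fun _ h => h.2.2)
    fun _ h => h.1.2.isPreconnected⟩, fun C hCX hC hyC => ?_⟩
  suffices closure C = univ by rw [this, univ_inter]
  by_contra hne
  obtain ⟨c, hc⟩ := hC.nonempty
  have hCc : IsSubcontinuum (closure C) := ⟨isClosed_closure.isCompact, hC.closure⟩
  exact hy (subset_meagerComposant_of_mem (hCX hc) hCc (hY.isNowhereDense hCc hne)
    (subset_closure hc) hyC)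

end IsIndecomposable

end Indecomposable

section Singular

theorem IsSingularWrt.dense (hX : IsSingularWrt X y) (hXd : Dense X) (hCX : C ⊆ X)
    (hC : IsConnected C) (hyC : y ∈ closure C) : Dense C :=
  dense_closure.1 (hXd.mono (inter_eq_right.1 (hX.2 C hCX hC hyC)))

theorem IsSingularDense.isNowhereDense_of_not_dense (hX : IsSingularDense X) (hCX : C ⊆ X)
    (hC : IsConnected C) (hCd : ¬ Dense C) : IsNowhereDense C := by
  obtain ⟨⟨y, hy⟩, hXd⟩ := hX
  by_contra hCn
  obtain ⟨A, B, hA, hB, hAd, hBd, rfl⟩ :=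
    exists_isConnected_union_eq_of_not_dense hy.1.isPreconnected hXd hC hCX hCd hCn
  have hyAB : y ∈ closure A ∪ closure B := by
    rw [← closure_union]
    exact hXd y
  exact hyAB.elim (fun h => hAd (hy.dense hXd subset_union_left hA h))
    fun h => hBd (hy.dense hXd subset_union_right hB h)

theorem IsFilament.exists_isNowhereDense_not_subset [CompactSpace Y] [T2Space Y]
    (hQ : IsFilament Q) (hpQ : p ∈ Q) (hH : IsSubcontinuum H) (hHn : ¬ IsNowhereDense H)
    (hpH : p ∈ H) :
    ∃ C, IsSubcontinuum C ∧ IsNowhereDense C ∧ p ∈ C ∧ C ⊆ H ∧ ¬ C ⊆ Q := by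
  obtain ⟨hQs, N, hN, hNn⟩ := hQ
  obtain ⟨V, hV, hQV, hVN⟩ := normal_exists_closure_subset hQs.1.isClosed isOpen_interior
    (subset_interior_iff_mem_nhdsSet.2 hN)
  have nowhereDense_of_subset (K : Set Y) (hK : IsConnected K) (hpK : p ∈ K)
      (hKV : K ⊆ closure V) : IsNowhereDense K :=
    (hNn p hpQ).mono (hK.isPreconnected.subset_connectedComponentIn hpK
      (hKV.trans (hVN.trans interior_subset)))
  obtain ⟨C, hC, hpC, hCHV, hCV⟩ := hH.exists_subset_closure_not_subset hV
    (fun h => hHn (nowhereDense_of_subset H hH.2 hpH (h.trans subset_closure))) hpH (hQV hpQ)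
  obtain ⟨hCH, hCV'⟩ := subset_inter_iff.1 hCHV
  exact ⟨C, hC, nowhereDense_of_subset C hC.2 hpC hCV', hpC, hCH, fun h => hCV (h.trans hQV)⟩

theorem exists_isGreatest_isNowhereDense [CompactSpace Y] [T2Space Y]
    (hX : IsSingularDense (meagerComposant x)) (hp : p ∈ meagerComposant x)
    (hH : IsClosed H) (hne : H ≠ univ) (hpH : p ∈ H) :
    ∃ Q, IsGreatest {K : Set Y | IsSubcontinuum K ∧ IsNowhereDense K ∧ p ∈ K ∧ K ⊆ H} Q := by
  set S : Set (Set Y) := {K | IsSubcontinuum K ∧ IsNowhereDense K ∧ p ∈ K ∧ K ⊆ H}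
  have hSH : ⋃₀ S ⊆ H := sUnion_subset fun K hK => hK.2.2.2
  have hpS : p ∈ ⋃₀ S := by
    obtain ⟨L, ⟨-, hLn, -⟩, hpL⟩ := hp
    exact ⟨{p}, ⟨⟨isCompact_singleton, isConnected_singleton⟩,
      hLn.mono (singleton_subset_iff.2 hpL), rfl, singleton_subset_iff.2 hpH⟩, rfl⟩
  have hSc : IsConnected (⋃₀ S) :=
    ⟨⟨p, hpS⟩, isPreconnected_sUnion p S (fun _ h => h.2.2.1) fun _ h => h.1.2.isPreconnected⟩
  have hSX : ⋃₀ S ⊆ meagerComposant x :=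
    sUnion_subset fun K hK => subset_meagerComposant_of_mem hp hK.1 hK.2.1 hK.2.2.1
  have hSn : IsNowhereDense (⋃₀ S) := hX.isNowhereDense_of_not_dense hSX hSc fun hd =>
    hne (hH.closure_eq ▸ (hd.mono hSH).closure_eq)
  exact ⟨closure (⋃₀ S), ⟨⟨isClosed_closure.isCompact, hSc.closure⟩, hSn.closure,
    subset_closure hpS, closure_minimal hSH hH⟩,
    fun K hK => (subset_sUnion_of_mem hK).trans subset_closure⟩

theorem IsSubcontinuum.isNowhereDense_of_isSingularDense [CompactSpace Y] [T2Space Y]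
    (hX : IsSingularDense (meagerComposant x)) (hfil : IsFilamentSet (meagerComposant x))
    (hH : IsSubcontinuum H) (hne : H ≠ univ) : IsNowhereDense H := by
  by_contra hHn
  have hint : (interior H).Nonempty :=
    nonempty_iff_ne_empty.2 fun h => hHn (hH.1.isClosed.isNowhereDense_iff.2 h)
  obtain ⟨p, hpint, hp⟩ := hX.2.inter_open_nonempty _ isOpen_interior hint
  have hpH : p ∈ H := interior_subset hpint
  obtain ⟨Q, ⟨hQ, hQn, hpQ, -⟩, hQmax⟩ :=
    exists_isGreatest_isNowhereDense hX hp hH.1.isClosed hne hpH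
  have hQfil : IsFilament Q := hfil Q hQ (subset_meagerComposant_of_mem hp hQ hQn hpQ)
  obtain ⟨C, hC, hCn, hpC, hCH, hCQ⟩ :=
    hQfil.exists_isNowhereDense_not_subset hpQ hH hHn hpH
  exact hCQ (hQmax ⟨hC, hCn, hpC, hCH⟩)

end Singular

end ContinuumTheory

/-- Here `Y` is a continuum: a compact connected metrizable space with more than one point. -/
theorem theorem1p4 (Y : Type*) [TopologicalSpace Y] [CompactSpace Y] [ConnectedSpace Y]
    [TopologicalSpace.MetrizableSpace Y] [Nontrivial Y] :
    ContinuumTheory.IsIndecomposable Y ↔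
      ∃ x : Y, ContinuumTheory.IsSingularDense (ContinuumTheory.meagerComposant x) ∧
        ContinuumTheory.IsFilamentSet (ContinuumTheory.meagerComposant x) := by
  constructor
  · intro hY
    let _ := TopologicalSpace.metrizableSpaceMetric Y
    obtain ⟨x⟩ : Nonempty Y := inferInstance
    have hne := hY.meagerComposant_ne_univ x
    obtain ⟨y, hy⟩ := (Set.ne_univ_iff_exists_notMem _).1 hne
    exact ⟨x, ⟨⟨y, hY.isSingularWrt_meagerComposant hy⟩, hY.dense_meagerComposant x⟩,
      hY.isFilamentSet hne⟩
  · rintro ⟨x, hX, hfil⟩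
    exact ContinuumTheory.isIndecomposable_iff_forall_isNowhereDense.2 fun K hK hne =>
      hK.isNowhereDense_of_isSingularDense hX hfil hne
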